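/- Let $D\ge 0$ be an even integer and write $[a,b]=\{a,a+1,\dots,b\}$ for $a\le b$ in $\mathbf Z$. An interval of $[1,D]$ is a subset of the form $[a,b]$ with $1\le a\le b\le D$. For $D\ge 2$ and $i\in[1,D]$ define a map $\xi_i$ from intervals of $[1,D-2]$ to intervals of $[1,D]$ by $\xi_i([a,b])=[a+2,b+2]$ if $i\le a$, $\xi_i([a,b])=[a,b]$ if $i\ge b+2$, and $\xi_i([a,b])=[a,b+2]$ if $a<i<b+2$; for a set $B'$ of intervals of $[1,D-2]$ put $t_i(B')=\{\xi_i(I');\,I'\in B'\}\cup\{\{i\}\}$. Define a collection $\mathbf S_D$ of sets of intervals of $[1,D]$ by induction on $D$: $\mathbf S_0=\{\emptyset\}$, and for $D\ge2$ a set $B$ of intervals of $[1,D]$ is in $\mathbf S_D$ if and only if either $B=\{[1,D],[2,D-1],\dots,[k,D+1-k]\}$ for some integer $0\le k\le D/2$ (with $B=\emptyset$ for $k=0$), or $B=t_i(B')$ for some $i\in[1,D]$ and $B'\in\mathbf S_{D-2}$. Let $V$ be the $\mathbf F_2$-vector space with basis $e_1,\dots,e_D$, and for an interval $I$ put $e_I=\sum_{i\in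 I}e_i$. For $B\in\mathbf S_D$ let $\langle B\rangle$ be the subspace of $V$ generated by $\{e_I;\,I\in B\}$, and let $\mathbf F(V)$ be the set of subspaces of $V$ of the form $\langle B\rangle$ with $B\in\mathbf S_D$. For $B\in\mathbf S_D$ and $h\in\{0,1\}$ let $B^h=\{I\in B;\,|I|\equiv h \bmod 2\}$; for $j\in[1,D]$ let $B^h_j=\{I\in B^h;\,j\in I\}$, let $\kappa\in\{0,1\}$ be the residue of $|B^0|$ modulo $2$, and put $f_j(B)=|B^1_j|-|B^0_j|-\kappa\in\mathbf Z$. Define $\epsilon:\mathbf S_D\to V$ by $\epsilon(B)=\sum_{j\in[1,D]}\epsilon_j(B)e_j$, where $\epsilon_j(B)\in\mathbf F_2$ is the class modulo $2$ of $f_j(B)(f_j(B)+1)/2$. Then $\epsilon$ is a bijection, and there is a unique bijection $e:V\to\mathbf F(V)$ such that $x\in e(x)$ for every $x\in V$. It is given by $e(x)=\langle\epsilon^{-1}(x)\rangle$. -/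

import Mathlib

namespace IntervalFamilies

/-- The interval `[a, b] = {a, a+1, …, b}` of natural numbers (with `a ≤ b`) is recorded by its
pair of end points `(a, b)`. -/
abbrev Interval : Type := ℕ × ℕ

/-- The number of elements of the interval. -/
def Interval.size (I : Interval) : ℕ := I.2 + 1 - I.1

/-- `j ∈ [a, b]`. -/
def Interval.Has (I : Interval) (j : ℕ) : Prop := I.1 ≤ j ∧ j ≤ I.2

instance (I : Interval) (j : ℕ) : Decidable (I.Has j) :=
  inferInstanceAs (Decidable (I.1 ≤ j ∧ j ≤ I.2))

/-- The map `ξ_i` from intervals of `[1, D]` to intervals of `[1, D + 2]`. -/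
def xi (i : ℕ) (I : Interval) : Interval :=
  if i ≤ I.1 then (I.1 + 2, I.2 + 2)
  else if I.2 + 2 ≤ i then (I.1, I.2)
  else (I.1, I.2 + 2)

/-- The map `t_i` on sets of intervals: apply `ξ_i` to every member and adjoin `{i} = [i, i]`. -/
def t (i : ℕ) (B : Finset Interval) : Finset Interval :=
  insert (i, i) (B.image (xi i))

/-- The set `{[1, D], [2, D - 1], …, [k, D + 1 - k]}`. -/
def prim (D k : ℕ) : Finset Interval :=
  (Finset.Icc 1 k).image fun j => (j, D + 1 - j)

/-- `Mem D B` says that `B` belongs to the family `𝐒_D` of sets of intervals of `[1, D]`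
(`D` even): `B` is primitive, or `B = t_i B'` with `B'` in `𝐒_{D-2}` and `i ∈ [1, D]`.
For `D = 0` the only member is the empty set. -/
inductive Mem : ℕ → Finset Interval → Prop
  | primitive (D k : ℕ) (hD : Even D) (hk : 2 * k ≤ D) : Mem D (prim D k)
  | step (D i : ℕ) (B : Finset Interval) (hi : i ∈ Finset.Icc 1 (D + 2)) (hB : Mem D B) :
      Mem (D + 2) (t i B)

/-- The set `𝐒_D`. -/
def SS (D : ℕ) : Set (Finset Interval) := {B | Mem D B}

/-- `B^h`, for `h = 0` or `h = 1`: the members of `B` whose size is congruent to `h` mod 2. -/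
def part (B : Finset Interval) (h : ℕ) : Finset Interval :=
  B.filter fun I => I.size % 2 = h

/-- `B^h_j`: the members of `B^h` that contain `j`. -/
def partAt (B : Finset Interval) (h j : ℕ) : Finset Interval :=
  (part B h).filter fun I => I.Has j

/-- `f_j(B) = |B^1_j| - |B^0_j| - κ`, where `κ ∈ {0, 1}` is the residue of `|B^0|` mod 2. -/
def f (B : Finset Interval) (j : ℕ) : ℤ :=
  ((partAt B 1 j).card : ℤ) - ((partAt B 0 j).card : ℤ) - (((part B 0).card % 2 : ℕ) : ℤ)

/-- The `𝔽₂`-vector space with basis `e_1, …, e_D`, in coordinates. -/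
abbrev V (D : ℕ) : Type := ↥(Finset.Icc 1 D) → ZMod 2

/-- `e_I`, the sum of the basis vectors `e_i` with `i ∈ I`. -/
def eVec (D : ℕ) (I : Interval) : V D :=
  ∑ i : ↥(Finset.Icc 1 D), if I.Has (i : ℕ) then Pi.single i 1 else 0

/-- `ε(B) = ∑_j ε_j(B) e_j`, where `ε_j(B)` is the class mod 2 of the integer
`f_j(B) (f_j(B) + 1) / 2` (the division is exact). -/
def eps (D : ℕ) (B : Finset Interval) : V D :=
  fun j => ((f B (j : ℕ) * (f B (j : ℕ) + 1) / 2 : ℤ) : ZMod 2)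

/-- `⟨B⟩`, the subspace generated by the vectors `e_I` with `I ∈ B`. -/
def gen (D : ℕ) (B : Finset Interval) : Submodule (ZMod 2) (V D) :=
  Submodule.span (ZMod 2) {v | ∃ I ∈ B, v = eVec D I}

/-- The set of subspaces of `V` of the form `⟨B⟩` with `B ∈ 𝐒_D`. -/
def FF (D : ℕ) : Set (Submodule (ZMod 2) (V D)) := {E | ∃ B ∈ SS D, E = gen D B}

/-- The map `ε : 𝐒_D → V`. -/
def epsMap (D : ℕ) : ↥(SS D) → V D := fun B => eps D B.1

end IntervalFamilies

/-! Each `B` is encoded by a lattice path `h` with steps ±1 from `0` to `2k + 1`, where `k = |B^0|`.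
Up to the shift by `κ`, `f_j(B)` is the `profile` of `h j`, a distance from the level `k + 1/2`.
Since `tri` has period 4 and satisfies `tri (-1 - n) = tri n`, the coordinates of `ε(B)` become `tri
(-h j - κ)`, which does not mention the distance (`tri_profile`). As `tri` separates `n` from `n +
2`, every vector can be read off as such a path (`exists_isPath`). Applying `t_i` inserts a strict
local maximum of the profile, and a path without one is that of a primitive `B`. Hence every path
comes from some `B` (`IsPath.exists_describes`), so `ε` is surjective.

Injectivity and uniqueness rest on triangularity: `ε(B) ∈ ⟨B⟩` (`Mem.eps_mem_gen`), while `ε(B) ∈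
⟨C⟩` forces `rank B ≤ rank C`, with equality only for `B = C` (`Mem.rank_le`). The second bijection
differs from `e` by a permutation of a finite set that never lowers the rank, hence by the identity.
-/

namespace IntervalFamilies

/-! ### Triangular numbers modulo 2. -/

/-- The class of the triangular number `n (n + 1) / 2` modulo 2. -/
def tri (n : ℤ) : ZMod 2 := ((n * (n + 1) / 2 : ℤ) : ZMod 2)

lemma tri_eq (n : ℤ) : tri n = if n % 4 = 1 ∨ n % 4 = 2 then 1 else 0 := by
  obtain ⟨q, r, hr, rfl⟩ : ∃ q r : ℤ, (r = 0 ∨ r = 1 ∨ r = 2 ∨ r = 3) ∧ n = 4 * q + r :=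
    ⟨n / 4, n % 4, by omega, by omega⟩
  have key : ∀ m : ℤ, (4 * q + r) * (4 * q + r + 1) = 2 * m → tri (4 * q + r) = (m : ZMod 2) := by
    intro m hm
    rw [tri, hm, Int.mul_ediv_cancel_left _ (by norm_num)]
  have h2 : ∀ z : ℤ, ((2 * z : ℤ) : ZMod 2) = 0 := fun z =>
    (ZMod.intCast_zmod_eq_zero_iff_dvd _ 2).2 ⟨z, by norm_num⟩
  rcases hr with rfl | rfl | rfl | rfl
  · rw [key (2 * (4 * q * q + q)) (by ring), h2, if_neg (by omega)]
  · rw [key (2 * (4 * q * q + 3 * q) + 1) (by ring), Int.cast_add, h2, if_pos (by omega)]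
    norm_num
  · rw [key (2 * (4 * q * q + 5 * q + 1) + 1) (by ring), Int.cast_add, h2, if_pos (by omega)]
    norm_num
  · rw [key (2 * (4 * q * q + 7 * q + 3)) (by ring), h2, if_neg (by omega)]

lemma tri_eq_tri_iff (m n : ℤ) :
    tri m = tri n ↔ ((m % 4 = 1 ∨ m % 4 = 2) ↔ (n % 4 = 1 ∨ n % 4 = 2)) := by
  rw [tri_eq, tri_eq]
  by_cases h1 : m % 4 = 1 ∨ m % 4 = 2 <;> by_cases h2 : n % 4 = 1 ∨ n % 4 = 2 <;> simp [h1, h2]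

lemma tri_eq_zero_iff (m : ℤ) : tri m = 0 ↔ ¬ (m % 4 = 1 ∨ m % 4 = 2) := by
  rw [tri_eq]
  by_cases h1 : m % 4 = 1 ∨ m % 4 = 2 <;> simp [h1]

/-! ### The effect of `t_i` on `f`. -/

/-- The map of positions that collapses `i - 1, i, i + 1` to `i - 1`. -/
def collapse (i j : ℕ) : ℕ := if j < i then j else if j = i then i - 1 else j - 2

lemma collapse_of_lt {i j : ℕ} (h : j < i) : collapse i j = j := if_pos h

lemma collapse_self (i : ℕ) : collapse i i = i - 1 := by simp [collapse]

lemma collapse_of_gt {i j : ℕ} (h : i < j) : collapse i j = j - 2 := by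
  rw [collapse, if_neg (by omega), if_neg (by omega)]

lemma has_xi {i j : ℕ} {I : Interval} (hi : 1 ≤ i) (h1 : 1 ≤ I.1) (h2 : I.1 ≤ I.2) :
    (xi i I).Has j ↔ I.Has (collapse i j) := by
  unfold xi collapse Interval.Has
  split_ifs <;> simp only <;> omega

lemma size_xi {i : ℕ} {I : Interval} (h2 : I.1 ≤ I.2) :
    (xi i I).size % 2 = I.size % 2 := by
  unfold xi Interval.size
  split_ifs <;> simp only <;> omega

lemma xi_ne_singleton {i : ℕ} {I : Interval} : xi i I ≠ (i, i) := by
  unfold xi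
  split_ifs <;> simp only [ne_eq, Prod.mk.injEq] <;> omega

lemma xi_injOn (i : ℕ) : Set.InjOn (xi i) {I | I.1 ≤ I.2} := by
  rintro ⟨a, b⟩ h ⟨c, d⟩ h' he
  simp only [Set.mem_ofPred_eq] at h h'
  unfold xi at he
  simp only at he
  split_ifs at he <;> simp only [Prod.mk.injEq] at he ⊢ <;> omega

lemma Mem.even {D : ℕ} {B : Finset Interval} (h : Mem D B) : Even D := by
  induction h with
  | primitive D k hD hk => exact hD
  | step D i B hi hB ih => exact ih.add even_two

lemma Mem.bounds {D : ℕ} {B : Finset Interval} (h : Mem D B) :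
    ∀ I ∈ B, 1 ≤ I.1 ∧ I.1 ≤ I.2 ∧ I.2 ≤ D := by
  induction h with
  | primitive D k hD hk =>
    intro I hI
    obtain ⟨j, hj, rfl⟩ := Finset.mem_image.1 hI
    rw [Finset.mem_Icc] at hj
    simp only
    omega
  | step D i B hi hB ih =>
    intro I hI
    rw [Finset.mem_Icc] at hi
    rcases Finset.mem_insert.1 hI with rfl | hI
    · simp only; omega
    · obtain ⟨J, hJ, rfl⟩ := Finset.mem_image.1 hI
      have := ih J hJ
      unfold xi
      split_ifs <;> simp only <;> omega

/-- The signed number of members of `B` that contain `j`: odd members count `1`, even ones `-1`. -/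
def depth (B : Finset Interval) (j : ℕ) : ℤ :=
  ∑ I ∈ B, if I.Has j then (if I.size % 2 = 1 then 1 else -1) else 0

lemma f_eq_depth (B : Finset Interval) (j : ℕ) :
    f B j = depth B j - (((part B 0).card % 2 : ℕ) : ℤ) := by
  have : depth B j = ((partAt B 1 j).card : ℤ) - ((partAt B 0 j).card : ℤ) := by
    unfold partAt part depth
    simp only [Finset.card_filter, Finset.sum_filter, Nat.cast_sum, ← Finset.sum_sub_distrib]
    refine Finset.sum_congr rfl fun I _ => ?_
    rcases Nat.mod_two_eq_zero_or_one I.size with h | h <;> by_cases hj : I.Has j <;> simp [h, hj]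
  rw [f, this]

lemma part_zero_card_t {i : ℕ} {B : Finset Interval} (hB : ∀ I ∈ B, I.1 ≤ I.2) :
    (part (t i B) 0).card = (part B 0).card := by
  have hnot : (i, i) ∉ B.image (xi i) := by
    intro h
    obtain ⟨J, -, h⟩ := Finset.mem_image.1 h
    exact xi_ne_singleton h
  unfold part t
  rw [Finset.card_filter, Finset.card_filter, Finset.sum_insert hnot,
    Finset.sum_image fun I hI J hJ h => xi_injOn i (hB I hI) (hB J hJ) h]
  have : Interval.size (i, i) % 2 = 1 := by simp [Interval.size]
  rw [this, if_neg one_ne_zero, zero_add]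
  exact Finset.sum_congr rfl fun I hI => by rw [size_xi (hB I hI)]

lemma depth_t {i : ℕ} {B : Finset Interval} (hi : 1 ≤ i) (hB : ∀ I ∈ B, 1 ≤ I.1 ∧ I.1 ≤ I.2)
    (j : ℕ) : depth (t i B) j = depth B (collapse i j) + if j = i then 1 else 0 := by
  have hnot : (i, i) ∉ B.image (xi i) := by
    intro h
    obtain ⟨J, -, h⟩ := Finset.mem_image.1 h
    exact xi_ne_singleton h
  unfold depth t
  rw [Finset.sum_insert hnot,
    Finset.sum_image fun I hI J hJ h => xi_injOn i (hB I hI).2 (hB J hJ).2 h, add_comm]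
  congr 1
  · refine Finset.sum_congr rfl fun I hI => ?_
    simp only [has_xi hi (hB I hI).1 (hB I hI).2, size_xi (hB I hI).2]
  · have h1 : Interval.size (i, i) % 2 = 1 := by simp [Interval.size]
    have h2 : Interval.Has (i, i) j ↔ j = i := by
      unfold Interval.Has
      simp only
      omega
    simp only [h1, h2, if_true]

/-- `ξ_i` preserves parity of size, and membership of `j` in the image is membership of `collapse i
j` in the original. Only the new odd interval `{i}` contributes more, so the graph of `f` acquires a
peak of height one at `i`. -/
lemma f_t {i : ℕ} {B : Finset Interval} (hi : 1 ≤ i) (hB : ∀ I ∈ B, 1 ≤ I.1 ∧ I.1 ≤ I.2)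
    (j : ℕ) : f (t i B) j = f B (collapse i j) + if j = i then 1 else 0 := by
  rw [f_eq_depth, f_eq_depth, depth_t hi hB, part_zero_card_t fun I hI => (hB I hI).2]
  ring

lemma Mem.f_t {D i : ℕ} {B : Finset Interval} (hB : Mem D B) (hi : 1 ≤ i) (j : ℕ) :
    f (t i B) j = f B (collapse i j) + if j = i then 1 else 0 :=
  IntervalFamilies.f_t hi (fun I hI => ⟨(hB.bounds I hI).1, (hB.bounds I hI).2.1⟩) j

lemma Mem.part_zero_card_t {D i : ℕ} {B : Finset Interval} (hB : Mem D B) :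
    (part (t i B) 0).card = (part B 0).card :=
  IntervalFamilies.part_zero_card_t fun I hI => (hB.bounds I hI).2.1

lemma prim_injOn {D k : ℕ} :
    Set.InjOn (fun j : ℕ => ((j, D + 1 - j) : Interval)) (Finset.Icc 1 k : Finset ℕ) := by
  intro a _ b _ h
  exact (Prod.mk.inj h).1

lemma part_zero_card_prim {D k : ℕ} (hD : Even D) (hk : 2 * k ≤ D) :
    (part (prim D k) 0).card = k := by
  have h : part (prim D k) 0 = prim D k := by
    unfold part
    rw [Finset.filter_eq_self]
    intro I hI
    obtain ⟨j, hj, rfl⟩ := Finset.mem_image.1 hI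
    rw [Finset.mem_Icc] at hj
    obtain ⟨m, rfl⟩ := hD
    simp only [Interval.size]
    omega
  rw [h, prim, Finset.card_image_of_injOn prim_injOn, Nat.card_Icc]
  omega

lemma f_prim {D k : ℕ} (hD : Even D) (hk : 2 * k ≤ D) (j : ℕ) :
    f (prim D k) j = -((min j (min (D + 1 - j) k) : ℕ) : ℤ) - ((k % 2 : ℕ) : ℤ) := by
  rw [f_eq_depth, part_zero_card_prim hD hk]
  congr 1
  unfold depth prim
  rw [Finset.sum_image prim_injOn]
  have : ∀ m ∈ Finset.Icc 1 k, (if Interval.Has (m, D + 1 - m) j then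
      (if Interval.size (m, D + 1 - m) % 2 = 1 then (1 : ℤ) else -1) else 0) =
      if m ∈ Finset.Icc 1 (min j (D + 1 - j)) then -1 else 0 := by
    intro m hm
    rw [Finset.mem_Icc] at hm
    have h1 : ¬ Interval.size (m, D + 1 - m) % 2 = 1 := by
      obtain ⟨n, rfl⟩ := hD
      simp only [Interval.size]
      omega
    have h2 : Interval.Has (m, D + 1 - m) j ↔ m ∈ Finset.Icc 1 (min j (D + 1 - j)) := by
      rw [Finset.mem_Icc]
      simp only [Interval.Has]
      omega
    rw [if_neg h1]
    simp only [h2]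
  rw [Finset.sum_congr rfl this, ← Finset.sum_filter, Finset.filter_mem_eq_inter, Finset.sum_const]
  have h3 : Finset.Icc 1 k ∩ Finset.Icc 1 (min j (D + 1 - j)) =
      Finset.Icc 1 (min j (min (D + 1 - j) k)) := by
    ext m
    simp only [Finset.mem_inter, Finset.mem_Icc]
    omega
  rw [h3, Nat.card_Icc]
  simp

/-! ### A member of the family is determined by its function `f` -/

/-- This exchange rule lets any singleton of `B` be regarded as the last one adjoined, which is how
`Mem.exists_eq_t` uses it. -/
lemma t_comm_of_le {i j : ℕ} (hij : i ≤ j) {B : Finset Interval} (hB : ∀ I ∈ B, I.1 ≤ I.2) :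
    t (j + 2) (t i B) = t i (t j B) := by
  unfold t
  rw [Finset.image_insert, Finset.image_insert, Finset.image_image, Finset.image_image,
    Finset.insert_comm]
  have h1 : xi (j + 2) (i, i) = (i, i) := by
    unfold xi; simp only; split_ifs <;> first | omega | rfl
  have h2 : xi i (j, j) = (j + 2, j + 2) := by
    unfold xi; simp only; split_ifs; rfl
  rw [h1, h2]
  congr 2
  refine Finset.image_congr fun I hI => ?_
  have := hB I hI
  obtain ⟨a, b⟩ := I
  simp only [Function.comp, xi] at this ⊢
  split_ifs <;> simp only [Prod.mk.injEq] at * <;> omega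

lemma Mem.exists_eq_t {D i : ℕ} {B : Finset Interval} (hB : Mem D B) (h : (i, i) ∈ B) :
    ∃ E B', D = E + 2 ∧ Mem E B' ∧ B = t i B' := by
  induction hB generalizing i with
  | primitive D k hD hk =>
    obtain ⟨j, hj, hji⟩ := Finset.mem_image.1 h
    rw [Finset.mem_Icc] at hj
    obtain ⟨m, rfl⟩ := hD
    simp only [Prod.mk.injEq] at hji
    omega
  | step D j B hj hB ih =>
    refine ⟨D, ?_⟩
    rw [Finset.mem_Icc] at hj
    rcases Finset.mem_insert.1 h with h | h
    · obtain rfl : i = j := (Prod.mk.inj h).1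
      exact ⟨B, rfl, hB, rfl⟩
    · obtain ⟨⟨a, b⟩, hI, hIi⟩ := Finset.mem_image.1 h
      have hb := hB.bounds _ hI
      simp only at hb
      have hab : (a = b ∧ a = i ∧ i + 2 ≤ j) ∨ (a = b ∧ a + 2 = i ∧ j ≤ a) := by
        unfold xi at hIi
        simp only at hIi
        split_ifs at hIi <;> simp only [Prod.mk.injEq] at hIi <;> omega
      rcases hab with ⟨rfl, rfl, hle⟩ | ⟨rfl, rfl, hle⟩
      · obtain ⟨E, B', rfl, hB', rfl⟩ := ih hI
        obtain ⟨l, rfl⟩ := Nat.exists_eq_add_of_le hle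
        refine ⟨t (a + l) B', rfl, Mem.step _ _ _ ?_ hB', ?_⟩
        · rw [Finset.mem_Icc]; omega
        · rw [show a + 2 + l = a + l + 2 by omega]
          exact t_comm_of_le (by omega) fun I hI => (hB'.bounds I hI).2.1
      · obtain ⟨E, B', rfl, hB', rfl⟩ := ih hI
        refine ⟨t j B', rfl, Mem.step _ _ _ ?_ hB', ?_⟩
        · rw [Finset.mem_Icc]; omega
        · exact (t_comm_of_le hle fun I hI => (hB'.bounds I hI).2.1).symm

/-- Strict peaks of `f` detect singletons. A primitive set has none, and a peak other than the newly
inserted one cannot be adjacent to it, so it survives the collapse. -/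
lemma Mem.singleton_mem {D i : ℕ} {B : Finset Interval} (hB : Mem D B) (hi : 1 ≤ i) (hiD : i ≤ D)
    (h1 : f B i = f B (i - 1) + 1) (h2 : f B i = f B (i + 1) + 1) : (i, i) ∈ B := by
  induction hB generalizing i with
  | primitive D k hD hk =>
    rw [f_prim hD hk, f_prim hD hk] at h1 h2
    omega
  | step D j B hj hB ih =>
    rw [Finset.mem_Icc] at hj
    rw [hB.f_t hj.1, hB.f_t hj.1] at h1 h2
    rcases lt_trichotomy i j with hij | rfl | hij
    · have e1 : collapse j i = i := if_pos hij
      have e2 : collapse j (i - 1) = i - 1 := by unfold collapse; split_ifs <;> omega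
      rw [e1, if_neg (by omega)] at h1 h2
      rw [e2, if_neg (by omega)] at h1
      by_cases hij' : i + 1 = j
      · have e3 : collapse j (i + 1) = i := by unfold collapse; split_ifs <;> omega
        rw [e3, if_pos hij'] at h2
        omega
      · have e3 : collapse j (i + 1) = i + 1 := by unfold collapse; split_ifs <;> omega
        rw [e3, if_neg hij'] at h2
        have := ih hi (by omega) (by omega) (by omega)
        refine Finset.mem_insert_of_mem (Finset.mem_image.2 ⟨_, this, ?_⟩)
        unfold xi
        simp only
        split_ifs <;> first | omega | rfl
    · exact Finset.mem_insert_self _ _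
    · have e1 : collapse j i = i - 2 := by unfold collapse; split_ifs <;> omega
      have e3 : collapse j (i + 1) = i - 1 := by unfold collapse; split_ifs <;> omega
      rw [e1, if_neg (by omega)] at h1 h2
      rw [e3, if_neg (by omega)] at h2
      by_cases hij' : i - 1 = j
      · have e2 : collapse j (i - 1) = i - 2 := by unfold collapse; split_ifs <;> omega
        rw [e2, if_pos hij'] at h1
        omega
      · have e2 : collapse j (i - 1) = i - 2 - 1 := by unfold collapse; split_ifs <;> omega
        rw [e2, if_neg hij'] at h1
        rw [show i - 1 = i - 2 + 1 by omega] at h2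
        have := ih (i := i - 2) (by omega) (by omega) (by omega) (by omega)
        refine Finset.mem_insert_of_mem (Finset.mem_image.2 ⟨_, this, ?_⟩)
        unfold xi
        simp only
        split_ifs <;> first | omega | (simp only [Prod.mk.injEq]; omega)

lemma f_t_peak {D i : ℕ} {B : Finset Interval} (hB : Mem D B) (hi : 1 ≤ i) :
    f (t i B) i = f (t i B) (i - 1) + 1 ∧ f (t i B) i = f (t i B) (i + 1) + 1 := by
  have e1 : collapse i i = i - 1 := by unfold collapse; split_ifs <;> omega
  have e2 : collapse i (i - 1) = i - 1 := by unfold collapse; split_ifs <;> omega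
  have e3 : collapse i (i + 1) = i - 1 := by unfold collapse; split_ifs <;> omega
  simp only [hB.f_t hi, e1, e2, e3, if_true]
  constructor
  · rw [if_neg (by omega)]; ring
  · rw [if_neg (by omega)]; ring

lemma exists_collapse_eq {D : ℕ} (i j : ℕ) (hj : j ≤ D + 1) :
    ∃ l, collapse i l = j ∧ l ≠ i ∧ l ≤ D + 3 := by
  by_cases h : j < i
  · exact ⟨j, by unfold collapse; split_ifs; rfl, by omega, by omega⟩
  · exact ⟨j + 2, by unfold collapse; split_ifs <;> omega, by omega, by omega⟩

/-- A peak of `f` gives a singleton common to both sets; stripping it from both leaves sets with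
equal `f`. -/
lemma Mem.eq_of_f_eq {D : ℕ} {B C : Finset Interval} (hB : Mem D B) (hC : Mem D C)
    (h : ∀ j ≤ D + 1, f B j = f C j) : B = C := by
  have main : ∀ D i B C, i ∈ Finset.Icc 1 (D + 2) → Mem D B → Mem (D + 2) C →
      (∀ C', Mem D C' → (∀ j ≤ D + 1, f B j = f C' j) → B = C') →
      (∀ j ≤ D + 3, f (t i B) j = f C j) → t i B = C := by
    intro D i B C hi hB hC ih h
    rw [Finset.mem_Icc] at hi
    have hp := f_t_peak hB hi.1
    rw [h _ (by omega), h _ (by omega), h _ (by omega)] at hp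
    obtain ⟨E, C', hE, hC', rfl⟩ := hC.exists_eq_t (hC.singleton_mem hi.1 hi.2 hp.1 hp.2)
    obtain rfl : D = E := by omega
    rw [ih C' hC' fun j hj => ?_]
    obtain ⟨l, rfl, hl, hlD⟩ := exists_collapse_eq i j hj
    have := h l hlD
    rwa [hB.f_t hi.1, hC'.f_t hi.1, if_neg hl, add_zero, add_zero] at this
  induction hB generalizing C with
  | step D i B hi hB ih => exact main D i B C hi hB hC (fun C' hC' => ih hC') h
  | primitive D k hD hk =>
    cases hC with
    | primitive D l hD hl =>
      -- The value at `0` gives the parity of `k`; the value in the middle is `-k - κ`.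
      have h0 := h 0 (by omega)
      have h1 := h (D / 2) (by omega)
      rw [f_prim hD hk, f_prim hD hl] at h0 h1
      obtain rfl : k = l := by
        obtain ⟨m, rfl⟩ := hD
        omega
      rfl
    | step D i C hi hC =>
      rw [Finset.mem_Icc] at hi
      have hp := f_t_peak hC hi.1
      rw [← h _ (by omega), ← h _ (by omega), ← h _ (by omega), f_prim hD hk, f_prim hD hk,
        f_prim hD hk] at hp
      omega

/-! ### Lattice paths and their profiles. -/

/-- `h` is a lattice path with `D + 1` steps `±1` from `0` to `2 k + 1`. -/
structure IsPath (D k : ℕ) (h : ℕ → ℤ) : Prop where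
  zero : h 0 = 0
  last : h (D + 1) = 2 * k + 1
  step : ∀ j ≤ D, h (j + 1) = h j + 1 ∨ h (j + 1) = h j - 1

/-- The distance of the height `n` from the level `k + 1/2`, shifted by `-(k + 1/2)`. -/
def profile (k : ℕ) (n : ℤ) : ℤ := max (-n) (n - 2 * k - 1)

/-- The two branches of the maximum, after subtracting `κ`, are exchanged by `n ↦ -1 - n` modulo 4,
because `2k + 2κ` is divisible by 4. -/
lemma tri_profile (k : ℕ) (n : ℤ) :
    tri (profile k n - ((k % 2 : ℕ) : ℤ)) = tri (-n - ((k % 2 : ℕ) : ℤ)) := by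
  rw [tri_eq_tri_iff, profile]
  rcases max_cases (-n) (n - 2 * k - 1) with ⟨h, -⟩ | ⟨h, -⟩ <;> rw [h]
  omega

namespace IsPath

variable {D k : ℕ} {h : ℕ → ℤ}

lemma sub_le (hp : IsPath D k h) (i d : ℕ) (hd : i + d ≤ D + 1) :
    h (i + d) ≤ h i + d ∧ h i - d ≤ h (i + d) := by
  induction d with
  | zero => simp
  | succ d ih =>
    have := ih (by omega)
    have := hp.step (i + d) (by omega)
    rw [← add_assoc]
    omega

lemma bounds (hp : IsPath D k h) (j : ℕ) (hj : j ≤ D + 1) :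
    h j ≤ j ∧ -(j : ℤ) ≤ h j ∧ 2 * (k : ℤ) + 1 - h j ≤ D + 1 - j := by
  have h1 := hp.sub_le 0 j (by omega)
  have h2 := hp.sub_le j (D + 1 - j) (by omega)
  have h3 := hp.zero
  have h4 := hp.last
  rw [zero_add] at h1
  rw [show j + (D + 1 - j) = D + 1 by omega] at h2
  omega

lemma parity (hp : IsPath D k h) (j : ℕ) (hj : j ≤ D + 1) : h j % 2 = (j : ℤ) % 2 := by
  induction j with
  | zero => simp [hp.zero]
  | succ j ih =>
    have := ih (by omega)
    have := hp.step j (by omega)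
    omega

lemma remove {i : ℕ} (hp : IsPath (D + 2) k h) (hi : 1 ≤ i) (hiD : i ≤ D + 2)
    (he : h (i - 1) = h (i + 1)) : IsPath D k fun j => if j < i then h j else h (j + 2) where
  zero := by rw [if_pos (by omega), hp.zero]
  last := by
    split_ifs with hlt
    · obtain rfl : i = D + 2 := by omega
      rw [show D + 1 = D + 2 - 1 by omega, he, hp.last]
    · exact hp.last
  step j hj := by
    have h1 := hp.step j (by omega)
    have h2 := hp.step (j + 2) (by omega)
    rcases lt_trichotomy (j + 1) i with hlt | rfl | hlt
    · rw [if_pos hlt, if_pos (by omega)]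
      exact h1
    · rw [if_neg (by omega), if_pos (by omega)]
      rw [add_tsub_cancel_right] at he
      rw [he]
      exact h2
    · rw [if_neg (by omega), if_neg (by omega)]
      exact h2

lemma insert {i : ℕ} (hp : IsPath D k h) (hi : 1 ≤ i) (hiD : i ≤ D + 2) {s : ℤ}
    (hs : s = 1 ∨ s = -1) :
    IsPath (D + 2) k fun j => h (collapse i j) + if j = i then s else 0 where
  zero := by
    rw [collapse, if_pos (by omega), if_neg (by omega), hp.zero, add_zero]
  last := by
    rw [collapse, if_neg (by omega), if_neg (by omega), if_neg (by omega), add_zero]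
    exact hp.last
  step j hj := by
    simp only [collapse]
    rcases lt_trichotomy (j + 1) i with hlt | rfl | hlt
    · have := hp.step j (by omega)
      rw [if_pos hlt, if_neg hlt.ne, if_pos (by omega), if_neg (by omega)]
      simpa using this
    · rw [if_neg (by omega), if_pos rfl, if_pos rfl, if_pos (by omega), if_neg (by omega),
        add_tsub_cancel_right]
      omega
    · rw [if_neg (by omega), if_neg hlt.ne', if_neg hlt.ne', if_neg (by omega)]
      rcases eq_or_lt_of_le (Nat.lt_succ_iff.1 hlt) with rfl | hlt'
      · rw [if_pos rfl, if_pos rfl, show i + 1 - 2 = i - 1 by omega]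
        omega
      · have := hp.step (j - 2) (by omega)
        rw [if_neg (by omega), if_neg (by omega), show j + 1 - 2 = j - 2 + 1 by omega]
        simpa using this

end IsPath

/-- The path climbs to `k`, zigzags between `k` and `k + 1`, then climbs to the end. -/
lemma isPath_prim {D k : ℕ} (hD : Even D) (hk : 2 * k ≤ D) :
    IsPath D k fun j => if j ≤ k then (j : ℤ) else
      if j ≤ D + 1 - k then k + ((j - k : ℕ) : ℤ) % 2 else (j : ℤ) + 2 * k - D where
  zero := by simp
  last := by
    obtain ⟨m, rfl⟩ := hD
    split_ifs <;> omega
  step j hj := by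
    obtain ⟨m, rfl⟩ := hD
    split_ifs <;> omega

/-- `h` is a path that describes `B`: its profile is the function `f` of `B`. -/
structure Describes (D : ℕ) (B : Finset Interval) (k : ℕ) (h : ℕ → ℤ) : Prop where
  isPath : IsPath D k h
  card : (part B 0).card = k
  f_eq : ∀ j ≤ D + 1, f B j = profile k (h j) - ((k % 2 : ℕ) : ℤ)

lemma Describes.eps_apply {D k : ℕ} {B : Finset Interval} {h : ℕ → ℤ} (hd : Describes D B k h)
    (j : ↥(Finset.Icc 1 D)) : eps D B j = tri (-h j - ((k % 2 : ℕ) : ℤ)) := by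
  have hj := Finset.mem_Icc.1 j.2
  rw [← tri_profile, ← hd.f_eq _ (by omega)]
  rfl

lemma Mem.exists_describes {D : ℕ} {B : Finset Interval} (hB : Mem D B) :
    ∃ k h, Describes D B k h := by
  induction hB with
  | primitive D k hD hk =>
    refine ⟨k, _, isPath_prim hD hk, part_zero_card_prim hD hk, fun j hj => ?_⟩
    rw [f_prim hD hk, profile]
    obtain ⟨m, rfl⟩ := hD
    split_ifs <;> omega
  | step D i B hi hB ih =>
    rw [Finset.mem_Icc] at hi
    obtain ⟨k, h, hd⟩ := ih
    refine ⟨k, _, hd.isPath.insert hi.1 hi.2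
      -- The inserted spike points away from the level `k + 1/2`, so that it raises the profile.
      (s := if h (collapse i i) ≤ k then -1 else 1) (by split_ifs <;> simp),
      hB.part_zero_card_t.trans hd.card, fun j hj => ?_⟩
    have hc : collapse i j ≤ D + 1 := by unfold collapse; split_ifs <;> omega
    rw [hB.f_t hi.1, hd.f_eq _ hc]
    by_cases hij : j = i
    · subst hij
      simp only [if_true, profile]
      split_ifs <;> omega
    · simp only [if_neg hij, add_zero]

/-- A path whose profile has no strict local maximum is the path of a primitive member. -/
lemma IsPath.profile_eq {D k : ℕ} {h : ℕ → ℤ} (hp : IsPath D k h)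
    (hno : ∀ i, 1 ≤ i → i ≤ D → h (i - 1) = h (i + 1) →
      profile k (h i) ≠ profile k (h (i - 1)) + 1) (j : ℕ) (hj : j ≤ D + 1) :
    profile k (h j) = -((min j (min (D + 1 - j) k) : ℕ) : ℤ) := by
  have hno' : ∀ i, i + 1 ≤ D → h i = h (i + 2) →
      profile k (h (i + 1)) ≠ profile k (h i) + 1 := fun i hi he => by
    simpa using hno (i + 1) (by omega) hi (by simpa using he)
  -- A descent from height at most `k` raises the profile; an ascent right after it would make a
  -- peak. So the path would descend forever and miss its endpoint.
  have low : ∀ i ≤ D, h (i + 1) = h i - 1 → ¬ h i ≤ k := by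
    intro i hi hdown hle
    have : ∀ d, i + d ≤ D → h (i + d + 1) = h (i + d) - 1 ∧ h (i + d) ≤ k := by
      intro d
      induction d with
      | zero => exact fun _ => ⟨hdown, hle⟩
      | succ d ih =>
        intro hd
        have h1 := ih (by omega)
        have h2 := hp.step (i + d + 1) (by omega)
        have h3 := hno' (i + d) (by omega)
        rw [← add_assoc]
        unfold profile at h3
        rw [show i + d + 1 + 1 = i + d + 2 by omega] at h2 ⊢
        omega
    have h1 := this (D - i) (by omega)
    rw [show i + (D - i) = D by omega] at h1
    have h2 := hp.last
    omega
  -- The mirror argument, run backwards: a descent from height at least `k + 2` must be preceded by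
  -- another, all the way back to the start at `0`.
  have high : ∀ i ≤ D, h (i + 1) = h i - 1 → h i < k + 2 := by
    intro i
    induction i with
    | zero =>
      intro _ _
      rw [hp.zero]
      omega
    | succ i ih =>
      intro hi hdown
      by_contra hge
      have h1 := hp.step i (by omega)
      have h3 := hno' i (by omega)
      have h4 := ih (by omega)
      unfold profile at h3
      rw [show i + 1 + 1 = i + 2 by omega] at hdown
      omega
  have left : ∀ j ≤ D + 1, h j = j ∨ (k : ℤ) ≤ h j := by
    intro j
    induction j with
    | zero => exact fun _ => Or.inl (by simp [hp.zero])
    | succ j ih =>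
      intro hj
      have h1 := ih (by omega)
      have h2 := hp.step j (by omega)
      have h3 := low j (by omega)
      omega
  have right : ∀ d ≤ D + 1, h (D + 1 - d) = 2 * k + 1 - d ∨ h (D + 1 - d) ≤ k + 1 := by
    intro d
    induction d with
    | zero => exact fun _ => Or.inl (by simp [hp.last])
    | succ d ih =>
      intro hj
      have h1 := ih (by omega)
      have h2 := hp.step (D + 1 - (d + 1)) (by omega)
      have h3 := high (D + 1 - (d + 1)) (by omega)
      rw [show D + 1 - (d + 1) + 1 = D + 1 - d by omega] at h2 h3
      omega
  have h1 := left j hj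
  have h2 := right (D + 1 - j) (by omega)
  rw [show D + 1 - (D + 1 - j) = j by omega] at h2
  have h3 := hp.bounds j hj
  unfold profile
  omega

/-- Induction on `D`: deleting a peak of the profile corresponds to undoing some `t_i`. -/
lemma IsPath.exists_describes {D k : ℕ} (hD : Even D) {h : ℕ → ℤ} (hp : IsPath D k h) :
    ∃ B, Mem D B ∧ Describes D B k h := by
  induction D using Nat.strong_induction_on generalizing h with
  | _ D ih =>
  by_cases hex : ∃ i, 1 ≤ i ∧ i ≤ D ∧ h (i - 1) = h (i + 1) ∧
      profile k (h i) = profile k (h (i - 1)) + 1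
  · obtain ⟨i, hi, hiD, he, hpr⟩ := hex
    obtain ⟨E, rfl⟩ : ∃ E, D = E + 2 := ⟨D - 2, by
      obtain ⟨m, rfl⟩ := hD
      omega⟩
    obtain ⟨B, hB, hd⟩ := ih E (by omega) ((Nat.even_add.1 hD).2 even_two) (hp.remove hi hiD he)
    refine ⟨t i B, Mem.step _ _ _ (Finset.mem_Icc.2 ⟨hi, hiD⟩) hB, hp,
      hB.part_zero_card_t.trans hd.card, fun j hj => ?_⟩
    have hc : collapse i j ≤ E + 1 := by unfold collapse; split_ifs <;> omega
    rw [hB.f_t hi, hd.f_eq _ hc]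
    rcases lt_trichotomy j i with hlt | rfl | hlt
    · simp [collapse_of_lt, hlt, hlt.ne]
    · rw [collapse_self, if_pos (by omega), if_pos rfl, hpr]
      ring
    · rw [collapse_of_gt hlt, if_neg hlt.ne', add_zero]
      by_cases hij : j = i + 1
      · subst hij
        rw [if_pos (by omega), show i + 1 - 2 = i - 1 by omega, he]
      · rw [if_neg (by omega), show j - 2 + 2 = j by omega]
  · have hk : 2 * k ≤ D := by
      have := hp.bounds 0 (by omega)
      have := hp.zero
      omega
    refine ⟨prim D k, Mem.primitive D k hD hk, hp, part_zero_card_prim hD hk, fun j hj => ?_⟩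
    rw [f_prim hD hk, hp.profile_eq (fun i h1 h2 h3 h4 => hex ⟨i, h1, h2, h3, h4⟩) j hj]

/-! ### From vectors to paths. -/

/-- The coordinates of a vector, extended by zero. -/
def coord (D : ℕ) (x : V D) (j : ℕ) : ZMod 2 :=
  if h : j ∈ Finset.Icc 1 D then x ⟨j, h⟩ else 0

lemma exists_walk (X : ℕ → ZMod 2) (hX : X 0 = 0) :
    ∃ g : ℕ → ℤ, g 0 = 0 ∧ (∀ j, g (j + 1) = g j + 1 ∨ g (j + 1) = g j - 1) ∧
      ∀ j, X j = tri (-g j) := by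
  let g : ℕ → ℤ := fun j => Nat.rec (motive := fun _ => ℤ) 0
    (fun j n => if X (j + 1) = tri (-(n + 1)) then n + 1 else n - 1) j
  have hg : ∀ j, g (j + 1) = if X (j + 1) = tri (-(g j + 1)) then g j + 1 else g j - 1 :=
    fun j => rfl
  refine ⟨g, rfl, fun j => ?_, fun j => ?_⟩
  · rw [hg]
    split_ifs <;> simp
  · cases j with
    | zero =>
      rw [hX]
      exact ((tri_eq_zero_iff _).2 (by simp [g])).symm
    | succ j =>
      rw [hg]
      split_ifs with h
      · exact h
      -- The two candidate heights differ by 2, so their `tri` values differ and one of them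
      -- matches.
      · have two : ∀ a b c : ZMod 2, a ≠ b → c ≠ b → a = c := by decide
        refine two _ _ _ h ?_
        rw [ne_eq, tri_eq_tri_iff]
        omega

lemma exists_isPath {D : ℕ} (hD : Even D) (x : V D) :
    ∃ k h, IsPath D k h ∧ ∀ j, coord D x j = tri (-h j - ((k % 2 : ℕ) : ℤ)) := by
  obtain ⟨g, h0, hs, hg⟩ := exists_walk (coord D x) (by simp [coord])
  have hpar : ∀ j, g j % 2 = (j : ℤ) % 2 := by
    intro j
    induction j with
    | zero => simp [h0]
    | succ j ih =>
      have := hs j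
      omega
  have hl : tri (-g (D + 1)) = 0 := by
    rw [← hg]
    simp [coord]
  rw [tri_eq_zero_iff] at hl
  have hp := hpar (D + 1)
  obtain ⟨m, rfl⟩ := hD
  -- The endpoint of `g` is 1 modulo 4. If positive it is `2k + 1` with `k` even; otherwise the
  -- reflected walk ends at `2k + 1` with `k` odd, and `κ = 1` absorbs the reflection.
  rcases le_or_gt 0 (g (m + m + 1)) with hpos | hneg
  · refine ⟨(g (m + m + 1)).toNat / 2, g, ⟨h0, by omega, fun j _ => hs j⟩, fun j => ?_⟩
    rw [hg, tri_eq_tri_iff]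
    omega
  · refine ⟨(-g (m + m + 1)).toNat / 2, fun j => -g j, ⟨by simp [h0], by omega, fun j _ => ?_⟩,
      fun j => ?_⟩
    · have := hs j
      omega
    · rw [hg, tri_eq_tri_iff]
      beta_reduce
      generalize g j = n
      omega

lemma coord_add {D : ℕ} (x y : V D) (j : ℕ) : coord D (x + y) j = coord D x j + coord D y j := by
  unfold coord
  split_ifs <;> simp

lemma coord_smul {D : ℕ} (c : ZMod 2) (x : V D) (j : ℕ) :
    coord D (c • x) j = c * coord D x j := by
  unfold coord
  split_ifs <;> simp

lemma coord_coe {D : ℕ} (x : V D) (j : ↥(Finset.Icc 1 D)) : coord D x j = x j :=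
  dif_pos j.2

lemma eVec_apply {D : ℕ} (I : Interval) (j : ↥(Finset.Icc 1 D)) :
    eVec D I j = if I.Has j then 1 else 0 := by
  unfold eVec
  rw [Finset.sum_apply, Finset.sum_eq_single j]
  · split_ifs <;> simp
  · intro i _ hij
    split_ifs
    · exact Pi.single_eq_of_ne hij.symm _
    · rfl
  · exact fun h => absurd (Finset.mem_univ j) h

lemma coord_eVec {D : ℕ} {I : Interval} (h1 : 1 ≤ I.1) (h2 : I.2 ≤ D) (j : ℕ) :
    coord D (eVec D I) j = if I.Has j then 1 else 0 := by
  unfold coord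
  split_ifs with hj hI hI
  · rw [eVec_apply, if_pos hI]
  · rw [eVec_apply, if_neg hI]
  · exact absurd (Finset.mem_Icc.2 ⟨h1.trans hI.1, hI.2.trans h2⟩) hj
  · rfl

/-! ### The subspaces `⟨B⟩`, and `ε(B) ∈ ⟨B⟩`. -/

/-- The linear map that repeats the coordinate at `i - 1` at the positions `i - 1, i, i + 1`. -/
def stretch (D i : ℕ) : V D →ₗ[ZMod 2] V (D + 2) where
  toFun x := fun j => coord D x (collapse i j)
  map_add' x y := funext fun _ => coord_add x y _
  map_smul' c x := funext fun _ => coord_smul c x _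

lemma stretch_eVec {D i : ℕ} {I : Interval} (hi : 1 ≤ i) (h1 : 1 ≤ I.1) (h12 : I.1 ≤ I.2)
    (h2 : I.2 ≤ D) : stretch D i (eVec D I) = eVec (D + 2) (xi i I) := by
  funext j
  rw [eVec_apply]
  change coord D (eVec D I) (collapse i j) = _
  rw [coord_eVec h1 h2]
  simp only [has_xi hi h1 h12]

lemma coord_stretch {D i j : ℕ} (hi : 1 ≤ i) (x : V D) :
    coord (D + 2) (stretch D i x) j = coord D x (collapse i j) := by
  by_cases hj : j ∈ Finset.Icc 1 (D + 2)
  · rw [coord, dif_pos hj]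
    rfl
  · rw [coord, dif_neg hj, coord, dif_neg]
    rw [Finset.mem_Icc] at hj ⊢
    unfold collapse
    split_ifs <;> omega

lemma gen_eq (D : ℕ) (B : Finset Interval) :
    gen D B = Submodule.span (ZMod 2) (eVec D '' (B : Set Interval)) := by
  unfold gen
  congr 1
  ext v
  simp [eq_comm]

lemma Mem.mem_gen_t {D i : ℕ} {B : Finset Interval} (hB : Mem D B) (hi : 1 ≤ i)
    (x : V (D + 2)) : x ∈ gen (D + 2) (t i B) ↔
      ∃ c : ZMod 2, ∃ y ∈ gen D B, x = c • eVec (D + 2) (i, i) + stretch D i y := by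
  have h : eVec (D + 2) '' (xi i '' (B : Set Interval)) =
      stretch D i '' (eVec D '' (B : Set Interval)) := by
    rw [Set.image_image, Set.image_image]
    refine Set.image_congr fun I hI => ?_
    have hb := hB.bounds I hI
    exact (stretch_eVec hi hb.1 hb.2.1 hb.2.2).symm
  rw [gen_eq, t, Finset.coe_insert, Finset.coe_image, Set.image_insert_eq, h,
    Submodule.mem_span_insert, ← Submodule.map_span, ← gen_eq]
  constructor
  · rintro ⟨c, _, ⟨y, hy, rfl⟩, rfl⟩
    exact ⟨c, y, hy, rfl⟩
  · rintro ⟨c, y, hy, rfl⟩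
    exact ⟨c, _, ⟨y, hy, rfl⟩, rfl⟩

/-- Extension by zero is consistent at the boundary: at `0` and `D + 1` the profile vanishes, and
`tri (-κ) = 0`. -/
lemma Mem.coord_eps {D : ℕ} {B : Finset Interval} (hB : Mem D B) {j : ℕ} (hj : j ≤ D + 1) :
    coord D (eps D B) j = tri (f B j) := by
  by_cases hm : j ∈ Finset.Icc 1 D
  · rw [coord, dif_pos hm]
    rfl
  · rw [coord, dif_neg hm, eq_comm, tri_eq_zero_iff]
    obtain ⟨k, h, hd⟩ := hB.exists_describes
    rw [hd.f_eq j hj]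
    have h0 := hd.isPath.zero
    have h1 := hd.isPath.last
    rw [Finset.mem_Icc] at hm
    obtain rfl | rfl : j = 0 ∨ j = D + 1 := by omega
    · rw [h0, profile]
      omega
    · rw [h1, profile]
      omega

/-- Telescoping: the nested interval starting at `m` gets the coefficient `u m - u (m - 1)`. -/
lemma mem_gen_prim {D k : ℕ} (u : ℕ → ZMod 2) (hu : u 0 = 0) :
    (fun j : ↥(Finset.Icc 1 D) => u (min j (min (D + 1 - j) k))) ∈ gen D (prim D k) := by
  induction k with
  | zero =>
    convert Submodule.zero_mem _ using 1
    funext j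
    simp [hu]
  | succ k ih =>
    have hmono : gen D (prim D k) ≤ gen D (prim D (k + 1)) := by
      rw [gen_eq, gen_eq]
      refine Submodule.span_mono (Set.image_mono ?_)
      rw [Finset.coe_subset]
      exact Finset.image_subset_image (Finset.Icc_subset_Icc_right (Nat.le_succ k))
    have hmem : eVec D (k + 1, D + 1 - (k + 1)) ∈ gen D (prim D (k + 1)) :=
      Submodule.subset_span ⟨_, Finset.mem_image.2 ⟨k + 1, by simp, rfl⟩, rfl⟩
    convert Submodule.add_mem _ (hmono ih)
      (Submodule.smul_mem _ (u (k + 1) - u k) hmem) using 1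
    funext j
    rw [Pi.add_apply, Pi.smul_apply, eVec_apply]
    have hj := Finset.mem_Icc.1 j.2
    by_cases hh : Interval.Has (k + 1, D + 1 - (k + 1)) j
    · rw [if_pos hh]
      simp only [Interval.Has] at hh
      rw [show min (j : ℕ) (min (D + 1 - j) (k + 1)) = k + 1 by omega,
        show min (j : ℕ) (min (D + 1 - j) k) = k by omega]
      simp
    · rw [if_neg hh]
      simp only [Interval.Has] at hh
      rw [show min (j : ℕ) (min (D + 1 - j) (k + 1)) = min (j : ℕ) (min (D + 1 - j) k) by omega]
      simp

lemma Mem.eps_mem_gen {D : ℕ} {B : Finset Interval} (hB : Mem D B) : eps D B ∈ gen D B := by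
  induction hB with
  | primitive D k hD hk =>
    convert mem_gen_prim (D := D) (k := k) (fun m => tri (-(m : ℤ) - ((k % 2 : ℕ) : ℤ))) ?_ using 1
    · funext j
      change tri (f (prim D k) j) = _
      rw [f_prim hD hk]
    · rw [tri_eq_zero_iff]
      omega
  | step D i B hi hB ih =>
    have hB' := Mem.step D i B hi hB
    rw [Finset.mem_Icc] at hi
    rw [hB.mem_gen_t hi.1]
    -- Away from `i`, `ε(t_i B)` is the stretch of `ε(B)`; the coefficient of `e_i` corrects the
    -- remaining coordinate.
    refine ⟨tri (f (t i B) i) - tri (f B (collapse i i)), _, ih, funext fun j => ?_⟩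
    have hj := Finset.mem_Icc.1 j.2
    rw [Pi.add_apply, Pi.smul_apply, eVec_apply, ← coord_coe (stretch _ _ _),
      coord_stretch hi.1, hB.coord_eps (by unfold collapse; split_ifs <;> omega)]
    change tri (f (t i B) j) = _
    by_cases hij : (j : ℕ) = i
    · rw [if_pos ⟨hij.ge, hij.le⟩, hij]
      simp
    · rw [if_neg fun h => hij (le_antisymm h.2 h.1), hB.f_t hi.1, if_neg hij]
      simp

/-! ### Triangularity of the relation `ε(B) ∈ ⟨C⟩`. -/

lemma coord_symm_of_mem_gen_prim {D k : ℕ} (hk : 2 * k ≤ D) {x : V D}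
    (hx : x ∈ gen D (prim D k)) :
    (∀ j ≤ D + 1, coord D x j = coord D x (D + 1 - j)) ∧
      ∀ j, k ≤ j → j + k ≤ D + 1 → coord D x j = coord D x k := by
  rw [gen_eq] at hx
  induction hx using Submodule.span_induction with
  | mem v hv =>
    obtain ⟨I, hI, rfl⟩ := hv
    obtain ⟨m, hm, rfl⟩ := Finset.mem_image.1 (Finset.mem_coe.1 hI)
    rw [Finset.mem_Icc] at hm
    constructor
    · intro j hj
      rw [coord_eVec hm.1 (by simp only; omega), coord_eVec hm.1 (by simp only; omega)]
      congr 1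
      simp only [Interval.Has, eq_iff_iff]
      omega
    · intro j hj hj'
      rw [coord_eVec hm.1 (by simp only; omega), coord_eVec hm.1 (by simp only; omega)]
      congr 1
      simp only [Interval.Has, eq_iff_iff]
      omega
  | zero => simp [coord]
  | add x y _ _ hx hy =>
    simp only [coord_add]
    exact ⟨fun j hj => by rw [hx.1 j hj, hy.1 j hj],
      fun j h1 h2 => by rw [hx.2 j h1 h2, hy.2 j h1 h2]⟩
  | smul c x _ hx =>
    simp only [coord_smul]
    exact ⟨fun j hj => by rw [hx.1 j hj], fun j h1 h2 => by rw [hx.2 j h1 h2]⟩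

/-- Symmetry of the coordinates makes the path symmetric about `k + 1/2`, and constancy in the
middle makes it zigzag there. The middle has odd length, so `h l` is `k` or `k + 1`, whence `k ≤ l`.
If `k = l`, the path must climb straight to `k`. -/
lemma IsPath.profile_le_f_prim {D k l : ℕ} {h : ℕ → ℤ} (hp : IsPath D k h) (hD : Even D)
    (hl : 2 * l ≤ D) {X : ℕ → ZMod 2} (hX : ∀ j ≤ D + 1, X j = tri (-h j - ((k % 2 : ℕ) : ℤ)))
    (hsymm : ∀ j ≤ D + 1, X j = X (D + 1 - j))
    (hconst : ∀ j, l ≤ j → j + l ≤ D + 1 → X j = X l) :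
    k ≤ l ∧ (k = l → ∀ j ≤ D + 1, profile k (h j) - ((k % 2 : ℕ) : ℤ) ≤ f (prim D l) j) := by
  have hsum4 : ∀ j ≤ D + 1, (h j + h (D + 1 - j) + 2 * ((k % 2 : ℕ) : ℤ)) % 4 = 1 := by
    intro j hj
    have h1 := hsymm j hj
    rw [hX j hj, hX _ (by omega), tri_eq_tri_iff] at h1
    have h2 := hp.parity j hj
    have h3 := hp.parity (D + 1 - j) (by omega)
    obtain ⟨m, rfl⟩ := hD
    omega
  -- Each step changes the sum by 0 or ±2, and `hsum4` fixes it modulo 4, so it is constant.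
  have hsum : ∀ j ≤ D + 1, h j + h (D + 1 - j) = 2 * k + 1 := by
    intro j
    induction j with
    | zero =>
      intro _
      rw [hp.zero, Nat.sub_zero, hp.last]
      ring
    | succ j ih =>
      intro hj
      have h1 := ih (by omega)
      have h2 := hsum4 j (by omega)
      have h3 := hsum4 (j + 1) hj
      have h4 := hp.step j (by omega)
      have h5 := hp.step (D + 1 - (j + 1)) (by omega)
      rw [show D + 1 - (j + 1) + 1 = D + 1 - j by omega] at h5
      omega
  have hmid : ∀ d, l + d + l ≤ D + 1 →
      h (l + d) = h l ∧ d % 2 = 0 ∨ h (l + d) = h (l + 1) ∧ d % 2 = 1 := by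
    intro d
    induction d using Nat.twoStepInduction with
    | zero => simp
    | one => simp
    | more d ih _ =>
      intro hd
      have h1 := ih (by omega)
      have h2 := hconst (l + d) (by omega) (by omega)
      rw [← hconst (l + (d + 2)) (by omega) (by omega), hX _ (by omega), hX _ (by omega),
        tri_eq_tri_iff] at h2
      have h3 := hp.step (l + d) (by omega)
      have h4 := hp.step (l + d + 1) (by omega)
      rw [show l + d + 1 + 1 = l + (d + 2) by omega] at h4
      omega
  have hend := hmid (D + 1 - 2 * l) (by omega)
  rw [show l + (D + 1 - 2 * l) = D + 1 - l by omega] at hend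
  have hl' := hsum l (by omega)
  have hb := hp.bounds l (by omega)
  have hs := hp.step l (by omega)
  have hpar : (D + 1 - 2 * l) % 2 = 1 := by
    obtain ⟨m, rfl⟩ := hD
    omega
  refine ⟨by omega, ?_⟩
  rintro rfl j hj
  have hkk : h k = k := by omega
  have hsmall : ∀ j ≤ k, h j = j := by
    intro j hjk
    have h1 := hp.bounds j (by omega)
    have h2 := hp.sub_le j (k - j) (by omega)
    rw [show j + (k - j) = k by omega] at h2
    omega
  rw [f_prim hD hl, profile]
  by_cases hj1 : j ≤ k
  · have := hsmall j hj1
    omega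
  by_cases hj2 : D + 1 - j ≤ k
  · have h1 := hsmall _ hj2
    have h2 := hsum j hj
    omega
  · have h1 := hmid (j - k) (by omega)
    rw [show k + (j - k) = j by omega] at h1
    omega

lemma Mem.profile_le {D k : ℕ} {B : Finset Interval} {h : ℕ → ℤ} {x : V D} (hB : Mem D B)
    (hx : x ∈ gen D B) (hp : IsPath D k h)
    (hX : ∀ j ≤ D + 1, coord D x j = tri (-h j - ((k % 2 : ℕ) : ℤ))) :
    k ≤ (part B 0).card ∧
      (k = (part B 0).card → ∀ j ≤ D + 1, profile k (h j) - ((k % 2 : ℕ) : ℤ) ≤ f B j) := by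
  induction hB generalizing h with
  | primitive D l hD hl =>
    rw [part_zero_card_prim hD hl]
    obtain ⟨h1, h2⟩ := coord_symm_of_mem_gen_prim hl hx
    exact hp.profile_le_f_prim hD hl hX h1 h2
  | step D i B hi hB ih =>
    rw [Finset.mem_Icc] at hi
    obtain ⟨c, y, hy, rfl⟩ := (hB.mem_gen_t hi.1 x).1 hx
    have hco : ∀ j, j ≠ i → coord (D + 2) (c • eVec (D + 2) (i, i) + stretch D i y) j =
        coord D y (collapse i j) := by
      intro j hj
      rw [coord_add, coord_smul, coord_stretch hi.1, coord_eVec hi.1 hi.2,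
        if_neg fun hh => hj (le_antisymm hh.2 hh.1), mul_zero, zero_add]
    -- The coordinates at `i - 1` and `i + 1` agree, and `tri` would distinguish heights differing
    -- by 2.
    have he : h (i - 1) = h (i + 1) := by
      have h1 := hco (i - 1) (by omega)
      have h2 := hco (i + 1) (by omega)
      rw [collapse_of_lt (by omega), hX _ (by omega)] at h1
      rw [collapse_of_gt (by omega), hX _ (by omega), show i + 1 - 2 = i - 1 by omega, ← h1,
        tri_eq_tri_iff] at h2
      have h3 := hp.step (i - 1) (by omega)
      have h4 := hp.step i (by omega)
      rw [show i - 1 + 1 = i by omega] at h3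
      omega
    obtain ⟨hle, hf⟩ := ih hy (hp.remove hi.1 hi.2 he) (fun j hj => by
      split_ifs with hlt
      · rw [← hX j (by omega), hco j hlt.ne, collapse_of_lt hlt]
      · rw [← hX (j + 2) (by omega), hco _ (by omega), collapse_of_gt (by omega)]
        rfl)
    rw [hB.part_zero_card_t]
    refine ⟨hle, fun hk j hj => ?_⟩
    have hc : collapse i j ≤ D + 1 := by unfold collapse; split_ifs <;> omega
    have h1 := hf hk _ hc
    rw [hB.f_t hi.1]
    rcases lt_trichotomy j i with hlt | rfl | hlt
    · rw [if_neg hlt.ne, add_zero]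
      rw [collapse_of_lt hlt] at h1 ⊢
      rwa [if_pos hlt] at h1
    · rw [if_pos rfl]
      rw [collapse_self, if_pos (by omega)] at h1
      rw [collapse_self]
      have h3 := hp.step (j - 1) (by omega)
      rw [show j - 1 + 1 = j by omega] at h3
      -- The profile changes by at most 1 per step, which the extra 1 in `f` at the inserted
      -- position covers.
      unfold profile at h1 ⊢
      omega
    · rw [if_neg hlt.ne', add_zero]
      rw [collapse_of_gt hlt] at h1 ⊢
      refine le_trans (le_of_eq ?_) h1
      by_cases hij : j = i + 1
      · subst hij
        rw [if_pos (by omega), show i + 1 - 2 = i - 1 by omega, he]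
      · rw [if_neg (by omega), show j - 2 + 2 = j by omega]

/-- The order on `𝐒_D` for which the incidence relation `ε(B) ∈ ⟨C⟩` is unitriangular. -/
def rank (D : ℕ) (B : Finset Interval) : ℕ ×ₗ ℤ :=
  toLex ((part B 0).card, ∑ j ∈ Finset.range (D + 2), f B j)

lemma Mem.rank_le {D : ℕ} {B C : Finset Interval} (hB : Mem D B) (hC : Mem D C)
    (h : eps D B ∈ gen D C) : rank D B ≤ rank D C ∧ (rank D B = rank D C → B = C) := by
  obtain ⟨k, p, hd⟩ := hB.exists_describes
  obtain ⟨hle, hf⟩ := hC.profile_le h hd.isPath fun j hj => by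
    rw [hB.coord_eps hj, hd.f_eq j hj, tri_profile]
  have hf' : (part B 0).card = (part C 0).card → ∀ j ∈ Finset.range (D + 2), f B j ≤ f C j := by
    intro he j hj
    have hj' : j ≤ D + 1 := Nat.lt_succ_iff.1 (Finset.mem_range.1 hj)
    rw [hd.f_eq j hj']
    exact hf (hd.card.symm.trans he) j hj'
  rw [← hd.card] at hle
  constructor
  · rw [rank, rank, Prod.Lex.toLex_le_toLex]
    rcases hle.lt_or_eq with hlt | he
    · exact Or.inl hlt
    · exact Or.inr ⟨he, Finset.sum_le_sum (hf' he)⟩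
  · intro he
    obtain ⟨h1, h2⟩ := Prod.mk.inj (toLex.injective he)
    refine hB.eq_of_f_eq hC fun j hj => ?_
    exact (Finset.sum_eq_sum_iff_of_le (hf' h1)).1 h2 j (Finset.mem_range.2 (by omega))

lemma Mem.eq_of_mem_gen {D : ℕ} {B C : Finset Interval} (hB : Mem D B) (hC : Mem D C)
    (h : eps D B ∈ gen D C) (h' : eps D C ∈ gen D B) : B = C :=
  (hB.rank_le hC h).2 (le_antisymm (hB.rank_le hC h).1 (hC.rank_le hB h').1)

/-! ### Bijectivity and uniqueness. -/

lemma epsMap_bijective {D : ℕ} (hD : Even D) : Function.Bijective (epsMap D) := by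
  constructor
  · rintro ⟨B, hB⟩ ⟨C, hC⟩ h
    have h' : eps D B = eps D C := h
    refine Subtype.ext (Mem.eq_of_mem_gen hB hC ?_ ?_)
    · rw [h']; exact Mem.eps_mem_gen hC
    · rw [← h']; exact Mem.eps_mem_gen hB
  · intro x
    obtain ⟨k, h, hp, hx⟩ := exists_isPath hD x
    obtain ⟨B, hB, hd⟩ := hp.exists_describes hD
    refine ⟨⟨B, hB⟩, funext fun j => ?_⟩
    rw [← coord_coe x, hx]
    exact hd.eps_apply j

/-- The map `B ↦ ⟨B⟩` from `𝐒_D` to the set of subspaces `⟨B⟩`. -/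
def genMap (D : ℕ) (B : ↥(SS D)) : ↥(FF D) := ⟨gen D B.1, B.1, B.2, rfl⟩

lemma genMap_bijective (D : ℕ) : Function.Bijective (genMap D) := by
  constructor
  · rintro ⟨B, hB⟩ ⟨C, hC⟩ h
    have h' : gen D B = gen D C := congrArg Subtype.val h
    refine Subtype.ext (Mem.eq_of_mem_gen hB hC ?_ ?_)
    · rw [← h']; exact Mem.eps_mem_gen hB
    · rw [h']; exact Mem.eps_mem_gen hC
  · rintro ⟨_, B, hB, rfl⟩
    exact ⟨⟨B, hB⟩, rfl⟩

/-- A permutation of a finite type that never decreases a rank preserves the rank. -/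
lemma rank_perm_eq {α β : Type*} [Finite α] [PartialOrder β] (r : α → β) (σ : Equiv.Perm α)
    (h : ∀ a, r a ≤ r (σ a)) (a : α) : r a = r (σ a) := by
  refine le_antisymm (h a) ?_
  have mono : ∀ n : ℕ, r (σ a) ≤ r ((σ ^ (n + 1)) a) := by
    intro n
    induction n with
    | zero => simp
    | succ n ih =>
      rw [pow_succ', Equiv.Perm.mul_apply]
      exact ih.trans (h _)
  have hpos := orderOf_pos σ
  have := mono (orderOf σ - 1)
  rwa [Nat.sub_add_cancel hpos, pow_orderOf_eq_one, Equiv.Perm.one_apply] at this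

end IntervalFamilies

open IntervalFamilies

theorem mainTheorem3 (D : ℕ) (hD : Even D) :
    ∃ (hε : Function.Bijective (IntervalFamilies.epsMap D))
      (e : IntervalFamilies.V D ≃ ↥(IntervalFamilies.FF D)),
      (∀ x : IntervalFamilies.V D, x ∈ (e x).1) ∧
      (∀ x : IntervalFamilies.V D,
        (e x).1 = IntervalFamilies.gen D ((Equiv.ofBijective _ hε).symm x).1) ∧
      ∀ e' : IntervalFamilies.V D ≃ ↥(IntervalFamilies.FF D),
        (∀ x : IntervalFamilies.V D, x ∈ (e' x).1) → e' = e := by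
  have hε := epsMap_bijective hD
  let E : ↥(SS D) ≃ V D := Equiv.ofBijective _ hε
  let G : ↥(SS D) ≃ ↥(FF D) := Equiv.ofBijective _ (genMap_bijective D)
  have hE : ∀ x, eps D (E.symm x).1 = x := E.apply_symm_apply
  refine ⟨hε, E.symm.trans G, fun x => ?_, fun x => rfl, fun e' he' => ?_⟩
  · have := Mem.eps_mem_gen (E.symm x).2
    rwa [hE] at this
  · have : Finite ↥(SS D) := Finite.of_equiv _ E.symm
    -- Transporting `e'` to `𝐒_D` turns `x ∈ e' x` into `ε(B) ∈ ⟨σ B⟩`.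
    let σ : Equiv.Perm ↥(SS D) := (E.trans e').trans G.symm
    have hσ : ∀ B, e' (E B) = G (σ B) := fun B => (G.apply_symm_apply _).symm
    have hmem : ∀ B : ↥(SS D), eps D B.1 ∈ gen D (σ B).1 := by
      intro B
      have h1 := he' (E B)
      rw [hσ] at h1
      exact h1
    have hfix : ∀ B, σ B = B := fun B => by
      have h1 := fun B : ↥(SS D) => Mem.rank_le B.2 (σ B).2 (hmem B)
      have h2 := rank_perm_eq (fun B : ↥(SS D) => rank D B.1) σ (fun B => (h1 B).1) B
      exact (Subtype.ext ((h1 B).2 h2)).symm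
    refine Equiv.ext fun x => ?_
    have h1 := hσ (E.symm x)
    rwa [E.apply_symm_apply, hfix] at h1
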